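/- For $\omega_0\in(0,\pi]$ put $q=e^{i\omega_0}(i\omega_0-2)+i\omega_0+2$, $p=e^{2i\omega_0}(i\omega_0-1)+i\omega_0+1$ and $$a_1=\tfrac{i\omega_0+1+e^{i\omega_0}(i\omega_0-1)}{q},\quad b_1=-\tfrac{i\omega_0(e^{i\omega_0}+1)}{q},\quad c_1=\tfrac1q,\quad d_1=-\tfrac{e^{i\omega_0}}{q},$$ $$a_2=\tfrac{p}{i\omega_0(e^{i\omega_0}-1)q},\quad b_2=-\tfrac{e^{i\omega_0}-1}{q},\quad c_2=\tfrac{e^{i\omega_0}-i\omega_0-1}{i\omega_0(e^{i\omega_0}-1)q},\quad d_2=-\tfrac{e^{i\omega_0}(e^{i\omega_0}(i\omega_0-1)+1)}{i\omega_0(e^{i\omega_0}-1)q},$$ and let $g_{j,\omega_0}(x)=a_j+b_jx+c_je^{i\omega_0x}+d_je^{-i\omega_0x}$ for $x\in[0,1]$ and $g_{j,\omega_0}(x)=0$ otherwise ($j=1,2$). For $\omega_0=0$ let $g_{1,0}(x)=(2x+1)(x-1)^2$ and $g_{2,0}(x)=x(x-1)^2$ on $[0,1]$, and $0$ otherwise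 (the limits as $\omega_0\to0$). Let $\phi_{1,\omega_0}$ be the even and $\phi_{2,\omega_0}$ the odd extension of these functions: for $x\ge0$, $\phi_{j,\omega_0}(x)=g_{j,\omega_0}(x)$, and for $x<0$, $\phi_{1,\omega_0}(x)=g_{1,\omega_0}(-x)$ and $\phi_{2,\omega_0}(x)=-g_{2,\omega_0}(-x)$. Put $\boldsymbol\phi_{\omega_0}=(\phi_{1,\omega_0},\phi_{2,\omega_0})^T$. **Theorem.** For every $\omega_0\in[0,\pi]$ the integer translates $\{\boldsymbol\phi_{\omega_0}(\cdot-n)\}_{n\in\mathbb Z}$ form a Riesz basis of the space $$S=\Big\{\sum_{n\in\mathbb Z}\mathbf a^T[n]\,\boldsymbol\phi_{\omega_0}(\cdot-n)\;:\;\mathbf a\in\ell_2(\mathbb Z;\mathbb C^2)\Big\}\subset L_2(\mathbb R;\mathbb C).$$ That is, $S$ is the closed linear span in $L_2(\mathbb R;\mathbb C)$ of the functions $\phi_{j,\omega_0}(\cdot-n)$, $j\in\{1,2\}$, $n\in\mathbb Z$, and there are constants $0<\alpha\le\beta<\infty$ such that for every $\mathbf a\in\ell_2(\mathbb Z;\mathbb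 C^2)$ the series $\sum_{n}\mathbf a^T[n]\boldsymbol\phi_{\omega_0}(\cdot-n)$ converges unconditionally in $L_2$ and $$\alpha\,\|\mathbf a\|_{\ell_2}\le\Big\|\sum_{n\in\mathbb Z}\mathbf a^T[n]\,\boldsymbol\phi_{\omega_0}(\cdot-n)\Big\|_{L_2}\le\beta\,\|\mathbf a\|_{\ell_2}.$$ -/

import Mathlib

open MeasureTheory

noncomputable section

namespace HermiteESpline

/-! ### Riesz bases -/

/-- `e` is a Riesz basis of the subset `V` of the Hilbert space `H`: `V` is the closed linear span
of `e`, every square-summable coefficient family gives a convergent series, and the norm of the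
sum is equivalent to the `ℓ²`-norm of the coefficients. -/
structure IsRieszBasis {ι H : Type*} [NormedAddCommGroup H] [InnerProductSpace ℂ H]
    (e : ι → H) (V : Set H) : Prop where
  closedSpan_eq : ((Submodule.span ℂ (Set.range e)).topologicalClosure : Set H) = V
  bounds : ∃ α β : ℝ, 0 < α ∧ α ≤ β ∧ ∀ a : lp (fun _ : ι => ℂ) 2,
    Summable (fun i => a i • e i) ∧
      α * ‖a‖ ≤ ‖∑' i, a i • e i‖ ∧ ‖∑' i, a i • e i‖ ≤ β * ‖a‖

/-! ### The generators on the unit interval -/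

/-- `p(ω) = e^{2iω}(iω - 1) + iω + 1`. -/
def pCoef (ω : ℝ) : ℂ :=
  Complex.exp (2 * Complex.I * ω) * (Complex.I * ω - 1) + Complex.I * ω + 1

/-- `q(ω) = e^{iω}(iω - 2) + iω + 2`. -/
def qCoef (ω : ℝ) : ℂ :=
  Complex.exp (Complex.I * ω) * (Complex.I * ω - 2) + Complex.I * ω + 2

/-- The constant coefficients `a₁(ω)`, `a₂(ω)` (the index `j = 1, 2` is `0, 1` in `Fin 2`). -/
def aCoef (ω : ℝ) : Fin 2 → ℂ :=
  ![(Complex.I * ω + 1 + Complex.exp (Complex.I * ω) * (Complex.I * ω - 1)) / qCoef ω,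
    pCoef ω / (Complex.I * ω * (Complex.exp (Complex.I * ω) - 1) * qCoef ω)]

/-- The coefficients `b₁(ω)`, `b₂(ω)` of `x`. -/
def bCoef (ω : ℝ) : Fin 2 → ℂ :=
  ![-(Complex.I * ω * (Complex.exp (Complex.I * ω) + 1)) / qCoef ω,
    -(Complex.exp (Complex.I * ω) - 1) / qCoef ω]

/-- The coefficients `c₁(ω)`, `c₂(ω)` of `e^{iωx}`. -/
def cCoef (ω : ℝ) : Fin 2 → ℂ :=
  ![1 / qCoef ω,
    (Complex.exp (Complex.I * ω) - Complex.I * ω - 1) /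
      (Complex.I * ω * (Complex.exp (Complex.I * ω) - 1) * qCoef ω)]

/-- The coefficients `d₁(ω)`, `d₂(ω)` of `e^{-iωx}`. -/
def dCoef (ω : ℝ) : Fin 2 → ℂ :=
  ![-Complex.exp (Complex.I * ω) / qCoef ω,
    -(Complex.exp (Complex.I * ω) * (Complex.exp (Complex.I * ω) * (Complex.I * ω - 1) + 1)) /
      (Complex.I * ω * (Complex.exp (Complex.I * ω) - 1) * qCoef ω)]

/-- The exponential polynomial `a_j + b_j x + c_j e^{iωx} + d_j e^{-iωx}`; for `ω = 0`, where the
coefficients are singular, its limit as `ω → 0`, the classical cubic Hermite polynomial. -/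
def piece (ω : ℝ) (j : Fin 2) (x : ℝ) : ℂ :=
  if ω = 0 then
    (![(2 * (x : ℂ) + 1) * ((x : ℂ) - 1) ^ 2, (x : ℂ) * ((x : ℂ) - 1) ^ 2] : Fin 2 → ℂ) j
  else
    aCoef ω j + bCoef ω j * x + cCoef ω j * Complex.exp (Complex.I * ω * x) +
      dCoef ω j * Complex.exp (-(Complex.I * ω * x))

/-- `g_j`, the restriction of the exponential polynomial to `[0, 1]`, extended by zero. -/
def g (ω : ℝ) (j : Fin 2) : ℝ → ℂ :=
  (Set.Icc (0 : ℝ) 1).indicator (piece ω j)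

/-- The generators: `φ₁ = φ ω 0` is the even extension of `g₁`, `φ₂ = φ ω 1` is the odd extension
of `g₂`. -/
def φ (ω : ℝ) (j : Fin 2) (x : ℝ) : ℂ :=
  if 0 ≤ x then g ω j x else (-1) ^ (j : ℕ) * g ω j (-x)

/-! ### The translates as elements of `L²(ℝ)` -/

theorem continuous_piece (ω : ℝ) (j : Fin 2) : Continuous (piece ω j) := by
  unfold piece
  split_ifs
  · fin_cases j <;> simp <;> fun_prop
  · fun_prop

theorem memLp_g (ω : ℝ) (j : Fin 2) : MemLp (g ω j) 2 (volume : Measure ℝ) := by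
  unfold g
  rw [memLp_indicator_iff_restrict measurableSet_Icc]
  obtain ⟨C, hC⟩ := isCompact_Icc.exists_bound_of_continuousOn
    (continuous_piece ω j).continuousOn (s := Set.Icc (0 : ℝ) 1)
  exact MemLp.of_bound (continuous_piece ω j).aestronglyMeasurable C
    ((ae_restrict_iff' measurableSet_Icc).2 (Filter.Eventually.of_forall hC))

theorem memLp_φ (ω : ℝ) (j : Fin 2) : MemLp (φ ω j) 2 (volume : Measure ℝ) := by
  have h1 := memLp_g ω j
  have h2 : MemLp (fun x => (-1 : ℂ) ^ (j : ℕ) * g ω j (-x)) 2 (volume : Measure ℝ) :=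
    (h1.comp_measurePreserving (Measure.measurePreserving_neg volume)).const_mul _
  exact MemLp.piecewise (s := Set.Ici (0 : ℝ)) measurableSet_Ici
    (h1.restrict _) (h2.restrict _)

theorem memLp_translate (ω : ℝ) (n : ℤ) (j : Fin 2) :
    MemLp (fun x : ℝ => φ ω j (x - n)) 2 (volume : Measure ℝ) :=
  (memLp_φ ω j).comp_measurePreserving (measurePreserving_sub_right volume (n : ℝ))

/-- The integer translate `φ_j(· - n)` in `L²(ℝ)`. -/
def translate (ω : ℝ) (i : ℤ × Fin 2) : Lp ℂ 2 (volume : Measure ℝ) :=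
  (memLp_translate ω i.1 i.2).toLp

/-! ### The spline space -/

/-- The function `x ↦ ∑ₙ a[n]ᵀ φ(x - n)`; for every `x` only finitely many terms are nonzero. -/
def series (ω : ℝ) (a : ℤ × Fin 2 → ℂ) (x : ℝ) : ℂ :=
  ∑' n : ℤ, (a (n, 0) * φ ω 0 (x - n) + a (n, 1) * φ ω 1 (x - n))

/-- The space of cardinal Hermite exponential splines `∑ₙ a[n]ᵀ φ(· - n)` with square-summable
coefficients, as a subset of `L²(ℝ)`. -/
def splineSpace (ω : ℝ) : Set (Lp ℂ 2 (volume : Measure ℝ)) :=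
  {f | ∃ a : lp (fun _ : ℤ × Fin 2 => ℂ) 2, f =ᵐ[volume] series ω a}

end HermiteESpline

end

noncomputable section

namespace HermiteESpline

/-! On each interval `[n, n + 1)` only the translates by `n` and `n + 1` are nonzero, so a spline is
there a combination of four fixed functions. These are linearly independent: values and derivatives
at the two endpoints return the coefficients (`eq_zero_of_localSum_ae_eq_zero`). An injective linear
map on a four-dimensional space is bounded above and below, with constants independent of `n`
(`exists_localSum_bounds`). Summing over `n` counts each coefficient twice (`tsum_window_sq`) and
gives the global bounds. The synthesis operator is thus bounded and bounded below; its range is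
closed and is the closed span of the translates. -/

/-- With `h = ω / 2`, `q = 4i e^{ih} (h cos h - sin h)`. The bracket vanishes only if `tan h = h`,
impossible for `0 < h < π / 2`; at `h = π / 2` it is `-1`. -/
theorem qCoef_ne_zero {ω : ℝ} (h0 : 0 < ω) (hπ : ω ≤ Real.pi) : qCoef ω ≠ 0 := by
  set h : ℝ := ω / 2 with hh
  have hω : ω = 2 * h := by rw [hh]; ring
  have hpos : 0 < h := by positivity
  have key : h * Real.cos h - Real.sin h ≠ 0 := by
    rcases hπ.lt_or_eq with hlt | heq
    · have hlt' : h < Real.pi / 2 := by linarith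
      have hc : 0 < Real.cos h := Real.cos_pos_of_mem_Ioo ⟨by linarith, hlt'⟩
      have ht := Real.lt_tan hpos hlt'
      rw [Real.tan_eq_sin_div_cos, lt_div_iff₀ hc] at ht
      linarith
    · have : h = Real.pi / 2 := by rw [hh, heq]
      simp [this]
  have hcs : (Real.cos h : ℂ) ^ 2 + (Real.sin h : ℂ) ^ 2 = 1 := by
    exact_mod_cast Real.cos_sq_add_sin_sq h
  have hE : Complex.exp (Complex.I * h) = Real.cos h + Real.sin h * Complex.I := by
    rw [mul_comm, Complex.exp_mul_I]; simp
  have hE2 : Complex.exp (Complex.I * ω) = Complex.exp (Complex.I * h) ^ 2 := by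
    rw [← Complex.exp_nat_mul, hω]; push_cast; ring_nf
  have hq : qCoef ω =
      Complex.exp (Complex.I * h) * (4 * Complex.I * ((h * Real.cos h - Real.sin h : ℝ) : ℂ)) := by
    rw [qCoef, hE2, hE, hω]
    push_cast
    push_cast at hcs
    linear_combination (-(2 * Complex.I * h + 2)) * hcs +
      (Complex.sin h : ℂ) ^ 2 * (2 * Complex.I * h + 2) * Complex.I_sq
  rw [hq]
  refine mul_ne_zero (Complex.exp_ne_zero _) (mul_ne_zero (by simp) ?_)
  exact_mod_cast key

theorem exp_I_mul_ne_one {ω : ℝ} (h0 : 0 < ω) (hπ : ω ≤ Real.pi) :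
    Complex.exp (Complex.I * ω) - 1 ≠ 0 := by
  intro h
  have h1 := congrArg Complex.re (sub_eq_zero.mp h)
  rw [mul_comm, Complex.exp_ofReal_mul_I_re, Complex.one_re] at h1
  have := Real.cos_lt_cos_of_nonneg_of_le_pi le_rfl hπ h0
  simp [h1] at this

/-! ### Hermite data of the pieces at the endpoints -/

/-- The derivative of the exponential polynomial `piece ω j`. -/
def pieceDeriv (ω : ℝ) (j : Fin 2) (x : ℝ) : ℂ :=
  if ω = 0 then
    (![6 * (x : ℂ) * ((x : ℂ) - 1), (3 * (x : ℂ) - 1) * ((x : ℂ) - 1)] : Fin 2 → ℂ) j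
  else
    bCoef ω j + cCoef ω j * (Complex.I * ω) * Complex.exp (Complex.I * ω * x) -
      dCoef ω j * (Complex.I * ω) * Complex.exp (-(Complex.I * ω * x))

theorem hasDerivAt_piece (ω : ℝ) (j : Fin 2) (x : ℝ) :
    HasDerivAt (piece ω j) (pieceDeriv ω j x) x := by
  have hx : HasDerivAt (fun y : ℝ => (y : ℂ)) 1 x := Complex.ofRealCLM.hasDerivAt
  unfold piece pieceDeriv
  split_ifs
  · fin_cases j
    · refine (((hx.const_mul 2).add_const 1).mul ((hx.sub_const 1).pow 2)).congr_deriv ?_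
      simp; ring
    · refine (hx.mul ((hx.sub_const 1).pow 2)).congr_deriv ?_
      simp; ring
  · have h1 := hx.const_mul (Complex.I * ω)
    refine ((((hx.const_mul (bCoef ω j)).const_add (aCoef ω j)).add
      (h1.cexp.const_mul (cCoef ω j))).add (h1.fun_neg.cexp.const_mul (dCoef ω j))).congr_deriv ?_
    ring

section
variable {ω : ℝ}

theorem piece_at_zero (hω : ω ∈ Set.Icc (0 : ℝ) Real.pi) (j : Fin 2) :
    piece ω j 0 = if j = 0 then 1 else 0 := by
  by_cases h : ω = 0
  · fin_cases j <;> simp [piece, h]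
  have h0 : 0 < ω := lt_of_le_of_ne hω.1 (Ne.symm h)
  have hq := qCoef_ne_zero h0 hω.2
  have he := exp_I_mul_ne_one h0 hω.2
  have hI : (ω : ℂ) ≠ 0 := by simp [h]
  have h2 : Complex.exp (2 * Complex.I * ω) = Complex.exp (Complex.I * ω) ^ 2 := by
    rw [← Complex.exp_nat_mul]; push_cast; ring_nf
  fin_cases j
  · simp [piece, h, aCoef, cCoef, dCoef]
    field_simp
    rw [qCoef]; ring
  · simp [piece, h, aCoef, cCoef, dCoef, pCoef, h2]
    field_simp
    ring

theorem piece_at_one (hω : ω ∈ Set.Icc (0 : ℝ) Real.pi) (j : Fin 2) :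
    piece ω j 1 = 0 := by
  by_cases h : ω = 0
  · fin_cases j <;> simp [piece, h]
  have h0 : 0 < ω := lt_of_le_of_ne hω.1 (Ne.symm h)
  have hq := qCoef_ne_zero h0 hω.2
  have he := exp_I_mul_ne_one h0 hω.2
  have hE := Complex.exp_ne_zero (Complex.I * ω)
  have hI : (ω : ℂ) ≠ 0 := by simp [h]
  have h2 : Complex.exp (2 * Complex.I * ω) = Complex.exp (Complex.I * ω) ^ 2 := by
    rw [← Complex.exp_nat_mul]; push_cast; ring_nf
  fin_cases j
  · simp [piece, h, aCoef, bCoef, cCoef, dCoef, Complex.exp_neg]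
    field_simp
    ring
  · simp [piece, h, aCoef, bCoef, cCoef, dCoef, pCoef, h2, Complex.exp_neg]
    field_simp
    ring

theorem pieceDeriv_at_zero (hω : ω ∈ Set.Icc (0 : ℝ) Real.pi) (j : Fin 2) :
    pieceDeriv ω j 0 = if j = 1 then 1 else 0 := by
  by_cases h : ω = 0
  · fin_cases j <;> simp [pieceDeriv, h]
  have h0 : 0 < ω := lt_of_le_of_ne hω.1 (Ne.symm h)
  have hq := qCoef_ne_zero h0 hω.2
  have he := exp_I_mul_ne_one h0 hω.2
  have hI : (ω : ℂ) ≠ 0 := by simp [h]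
  fin_cases j
  · simp [pieceDeriv, h, bCoef, cCoef, dCoef]
    field_simp
    ring
  · simp [pieceDeriv, h, bCoef, cCoef, dCoef]
    field_simp
    rw [qCoef]; ring

theorem pieceDeriv_at_one (hω : ω ∈ Set.Icc (0 : ℝ) Real.pi) (j : Fin 2) :
    pieceDeriv ω j 1 = 0 := by
  by_cases h : ω = 0
  · fin_cases j <;> simp [pieceDeriv, h]
  have h0 : 0 < ω := lt_of_le_of_ne hω.1 (Ne.symm h)
  have hq := qCoef_ne_zero h0 hω.2
  have he := exp_I_mul_ne_one h0 hω.2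
  have hE := Complex.exp_ne_zero (Complex.I * ω)
  have hI : (ω : ℂ) ≠ 0 := by simp [h]
  fin_cases j
  · simp [pieceDeriv, h, bCoef, cCoef, dCoef, Complex.exp_neg]
    field_simp
    ring
  · simp [pieceDeriv, h, bCoef, cCoef, dCoef, Complex.exp_neg]
    field_simp
    ring

end

theorem φ_apply_of_mem {ω t : ℝ} (j : Fin 2) (ht : t ∈ Set.Ico (0 : ℝ) 1) :
    φ ω j t = piece ω j t := by
  rw [φ, if_pos ht.1, g, Set.indicator_of_mem (Set.Ico_subset_Icc_self ht)]

theorem φ_sub_one_of_mem {ω t : ℝ} (j : Fin 2) (ht : t ∈ Set.Ico (0 : ℝ) 1) :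
    φ ω j (t - 1) = (-1) ^ (j : ℕ) * piece ω j (1 - t) := by
  rw [φ, if_neg (by linarith [ht.2]), g, neg_sub,
    Set.indicator_of_mem (Set.mem_Icc.2 ⟨by linarith [ht.2], by linarith [ht.1]⟩)]

theorem φ_eq_zero_of_one_le_abs {ω : ℝ} (hω : ω ∈ Set.Icc (0 : ℝ) Real.pi) (j : Fin 2) {x : ℝ}
    (hx : 1 ≤ |x|) : φ ω j x = 0 := by
  have key : ∀ y : ℝ, 1 ≤ y → g ω j y = 0 := by
    intro y hy
    rcases hy.eq_or_lt with rfl | hlt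
    · rw [g, Set.indicator_of_mem (by simp), piece_at_one hω]
    · exact Set.indicator_of_notMem (fun h => absurd h.2 (not_le.2 hlt)) _
  unfold φ
  split_ifs with h
  · exact key x (by rwa [abs_of_nonneg h] at hx)
  · rw [key (-x) (by rwa [abs_of_neg (not_le.1 h)] at hx), mul_zero]

/-! ### Norm equivalence on the unit interval -/

/-- The combination of the four translates that do not vanish on `[0, 1)`. -/
def localSum (ω : ℝ) (v : Fin 2 × Fin 2 → ℂ) (t : ℝ) : ℂ :=
  ∑ k, v k * φ ω k.2 (t - (((k.1 : ℕ) : ℤ) : ℝ))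

theorem memLp_localSum (ω : ℝ) (v : Fin 2 × Fin 2 → ℂ) :
    MemLp (localSum ω v) 2 (volume.restrict (Set.Ico (0 : ℝ) 1)) :=
  memLp_finsetSum _ fun k _ =>
    ((memLp_translate ω ((k.1 : ℕ) : ℤ) k.2).restrict _).const_mul (v k)

theorem localSum_add (ω : ℝ) (v w : Fin 2 × Fin 2 → ℂ) :
    localSum ω (v + w) = localSum ω v + localSum ω w := by
  ext t
  simp [localSum, add_mul, Finset.sum_add_distrib]

theorem localSum_smul (ω : ℝ) (c : ℂ) (v : Fin 2 × Fin 2 → ℂ) :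
    localSum ω (c • v) = c • localSum ω v := by
  ext t
  simp only [localSum, Pi.smul_apply, smul_eq_mul, Finset.mul_sum, mul_assoc]

/-- Hermite interpolation: the four local functions are linearly independent. -/
theorem eq_zero_of_localSum_ae_eq_zero {ω : ℝ} (hω : ω ∈ Set.Icc (0 : ℝ) Real.pi)
    {v : Fin 2 × Fin 2 → ℂ}
    (h : localSum ω v =ᵐ[volume.restrict (Set.Ico (0 : ℝ) 1)] 0) : v = 0 := by
  -- A smooth formula on all of `ℝ` agreeing with `localSum` on `[0, 1)`; the minus sign comes from
  -- the odd extension.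
  set L : ℝ → ℂ := fun t => v (0, 0) * piece ω 0 t + v (0, 1) * piece ω 1 t +
    (v (1, 0) * piece ω 0 (1 - t) - v (1, 1) * piece ω 1 (1 - t)) with hL
  have hcont : Continuous L := by
    have h0 := continuous_piece ω 0
    have h1 := continuous_piece ω 1
    fun_prop
  have hderiv : ∀ t, HasDerivAt L (v (0, 0) * pieceDeriv ω 0 t + v (0, 1) * pieceDeriv ω 1 t +
      (v (1, 0) * -pieceDeriv ω 0 (1 - t) - v (1, 1) * -pieceDeriv ω 1 (1 - t))) t := by
    intro t
    have hr : ∀ j, HasDerivAt (fun s => piece ω j (1 - s)) (-pieceDeriv ω j (1 - t)) t :=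
      fun j => HasDerivAt.comp_const_sub 1 t (hasDerivAt_piece ω j (1 - t))
    exact (((hasDerivAt_piece ω 0 t).const_mul _).add ((hasDerivAt_piece ω 1 t).const_mul _)).add
      (((hr 0).const_mul _).sub ((hr 1).const_mul _))
  have hLae : L =ᵐ[volume.restrict (Set.Icc (0 : ℝ) 1)] 0 := by
    rw [← restrict_Ico_eq_restrict_Icc]
    filter_upwards [h, ae_restrict_mem measurableSet_Ico] with t ht hmem
    rw [← ht, hL, localSum, Fintype.sum_prod_type]
    simp [φ_apply_of_mem _ hmem, φ_sub_one_of_mem _ hmem]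
    ring
  have hzero : Set.EqOn L 0 (Set.Icc 0 1) :=
    Measure.eqOn_Icc_of_ae_eq volume zero_ne_one hLae hcont.continuousOn continuousOn_const
  have hderiv0 : ∀ t ∈ Set.Icc (0 : ℝ) 1,
      v (0, 0) * pieceDeriv ω 0 t + v (0, 1) * pieceDeriv ω 1 t +
      (v (1, 0) * -pieceDeriv ω 0 (1 - t) - v (1, 1) * -pieceDeriv ω 1 (1 - t)) = 0 := by
    intro t ht
    -- One-sided derivatives are still unique at the endpoints, where they are needed.
    refine (uniqueDiffOn_Icc zero_lt_one t ht).eq_deriv _ (hderiv t).hasDerivWithinAt ?_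
    exact (hasDerivWithinAt_const t _ (0 : ℂ)).congr hzero (hzero ht)
  have e0 := hzero (Set.left_mem_Icc.2 zero_le_one)
  have e1 := hzero (Set.right_mem_Icc.2 zero_le_one)
  have d0 := hderiv0 0 (Set.left_mem_Icc.2 zero_le_one)
  have d1 := hderiv0 1 (Set.right_mem_Icc.2 zero_le_one)
  simp [hL, piece_at_zero hω, piece_at_one hω] at e0 e1
  simp [pieceDeriv_at_zero hω, pieceDeriv_at_one hω] at d0 d1
  ext ⟨k, j⟩
  fin_cases k <;> fin_cases j <;> simpa

/-- `localSum` as a linear map into `L²([0, 1))`. -/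
def localMap (ω : ℝ) :
    EuclideanSpace ℂ (Fin 2 × Fin 2) →ₗ[ℂ] Lp ℂ 2 (volume.restrict (Set.Ico (0 : ℝ) 1)) where
  toFun v := (memLp_localSum ω v).toLp
  map_add' v w := by
    rw [← MemLp.toLp_add]
    exact MemLp.toLp_congr _ _ (.of_eq (localSum_add ω v w))
  map_smul' c v := by
    rw [RingHom.id_apply, ← MemLp.toLp_const_smul]
    exact MemLp.toLp_congr _ _ (.of_eq (localSum_smul ω c v))

theorem localMap_injective {ω : ℝ} (hω : ω ∈ Set.Icc (0 : ℝ) Real.pi) :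
    LinearMap.ker (localMap ω) = ⊥ := by
  rw [LinearMap.ker_eq_bot']
  intro v hv
  have h := (MemLp.toLp_eq_toLp_iff (memLp_localSum ω v) MemLp.zero).1
    (hv.trans (MemLp.toLp_zero _).symm)
  ext k
  exact congrFun (eq_zero_of_localSum_ae_eq_zero hω h) k

theorem enorm_toLp_sq {α : Type*} [MeasurableSpace α] {μ : Measure α} {f : α → ℂ}
    (hf : MemLp f 2 μ) : ‖hf.toLp‖ₑ ^ 2 = ∫⁻ x, ‖f x‖ₑ ^ 2 ∂μ := by
  have := eLpNorm_nnreal_pow_eq_lintegral (f := f) (μ := μ) (p := 2) two_ne_zero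
  rw [Lp.enorm_toLp]
  simpa using this

theorem enorm_sq_eq_sum {ι : Type*} [Fintype ι] (v : EuclideanSpace ℂ ι) :
    ‖v‖ₑ ^ 2 = ∑ i, ‖v i‖ₑ ^ 2 := by
  simp only [enorm_eq_nnnorm]
  norm_cast
  rw [EuclideanSpace.nnnorm_eq, NNReal.sq_sqrt]

theorem exists_localSum_bounds {ω : ℝ} (hω : ω ∈ Set.Icc (0 : ℝ) Real.pi) :
    ∃ K C : NNReal, 0 < K ∧ ∀ v : Fin 2 × Fin 2 → ℂ,
      ∑ k, ‖v k‖ₑ ^ 2 ≤ (K : ENNReal) ^ 2 * ∫⁻ t in Set.Ico (0 : ℝ) 1, ‖localSum ω v t‖ₑ ^ 2 ∧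
      ∫⁻ t in Set.Ico (0 : ℝ) 1, ‖localSum ω v t‖ₑ ^ 2 ≤ (C : ENNReal) ^ 2 * ∑ k, ‖v k‖ₑ ^ 2 := by
  obtain ⟨K, hK, hT⟩ := (localMap ω).exists_antilipschitzWith (localMap_injective hω)
  set T := (localMap ω).toContinuousLinearMap
  refine ⟨K, ‖T‖₊, hK, fun v => ?_⟩
  set w : EuclideanSpace ℂ (Fin 2 × Fin 2) := WithLp.toLp 2 v
  have h1 : ∑ k, ‖v k‖ₑ ^ 2 = ‖w‖ₑ ^ 2 := (enorm_sq_eq_sum w).symm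
  have h2 : ∫⁻ t in Set.Ico (0 : ℝ) 1, ‖localSum ω v t‖ₑ ^ 2 = ‖localMap ω w‖ₑ ^ 2 :=
    (enorm_toLp_sq (memLp_localSum ω v)).symm
  rw [h1, h2, ← mul_pow, ← mul_pow]
  constructor
  · gcongr
    simpa using hT w 0
  · gcongr
    have := T.le_opENorm w
    exact this

/-! ### From unit intervals to the line -/

/-- The coefficients of the four translates that do not vanish on `[n, n + 1)`. -/
def window (a : ℤ × Fin 2 → ℂ) (n : ℤ) (k : Fin 2 × Fin 2) : ℂ :=
  a (n + ((k.1 : ℕ) : ℤ), k.2)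

/-- At integer `x` the translate by `⌊x⌋ - 1` also touches `x`; it drops out because the pieces
vanish at `1`. -/
theorem series_eq_localSum {ω : ℝ} (hω : ω ∈ Set.Icc (0 : ℝ) Real.pi) (a : ℤ × Fin 2 → ℂ)
    (x : ℝ) : series ω a x = localSum ω (window a ⌊x⌋) (x - ⌊x⌋) := by
  have hne : ⌊x⌋ ≠ ⌊x⌋ + 1 := by omega
  rw [series, tsum_eq_sum (s := {⌊x⌋, ⌊x⌋ + 1})]
  · rw [Finset.sum_pair hne, localSum, Fintype.sum_prod_type]
    simp [window, -Int.self_sub_floor, sub_sub]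
  · intro m hm
    simp only [Finset.mem_insert, Finset.mem_singleton, not_or] at hm
    have hle : 1 ≤ |x - m| := by
      rcases lt_or_ge m ⌊x⌋ with h | h
      · have h' : (m : ℝ) + 1 ≤ ⌊x⌋ := by exact_mod_cast h
        exact le_abs.2 (.inl (by linarith [Int.floor_le x]))
      · have h' : (⌊x⌋ : ℝ) + 2 ≤ m := by
          have : ⌊x⌋ + 2 ≤ m := by omega
          exact_mod_cast this
        exact le_abs.2 (.inr (by linarith [Int.lt_floor_add_one x]))
    rw [φ_eq_zero_of_one_le_abs hω 0 hle, φ_eq_zero_of_one_le_abs hω 1 hle]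
    simp

theorem measurable_φ (ω : ℝ) (j : Fin 2) : Measurable (φ ω j) := by
  have h : Measurable (g ω j) := (continuous_piece ω j).measurable.indicator measurableSet_Icc
  exact Measurable.ite measurableSet_Ici h ((h.comp measurable_neg).const_mul _)

theorem measurable_series {ω : ℝ} (hω : ω ∈ Set.Icc (0 : ℝ) Real.pi) (a : ℤ × Fin 2 → ℂ) :
    Measurable (series ω a) := by
  simp only [funext (series_eq_localSum hω a), localSum, window]
  refine Finset.measurable_fun_sum _ fun k _ => Measurable.mul ?_ ?_
  · exact (measurable_of_countable fun n : ℤ => a (n + ((k.1 : ℕ) : ℤ), k.2)).comp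
      Int.measurable_floor
  · refine (measurable_φ ω k.2).comp ((measurable_id.sub ?_).sub_const _)
    exact (measurable_of_countable fun n : ℤ => (n : ℝ)).comp Int.measurable_floor

theorem lintegral_eq_tsum_Ico (f : ℝ → ENNReal) :
    ∫⁻ x, f x = ∑' n : ℤ, ∫⁻ t in Set.Ico (0 : ℝ) 1, f (t + n) := by
  rw [← setLIntegral_univ, ← iUnion_Ico_intCast ℝ,
    lintegral_iUnion (fun _ => measurableSet_Ico) (Set.pairwise_disjoint_Ico_intCast ℝ)]
  refine tsum_congr fun n => ?_
  rw [← (measurePreserving_add_right volume (n : ℝ)).setLIntegral_comp_preimage_emb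
    (measurableEmbedding_addRight (n : ℝ))]
  simp

theorem lintegral_series_sq {ω : ℝ} (hω : ω ∈ Set.Icc (0 : ℝ) Real.pi) (a : ℤ × Fin 2 → ℂ) :
    ∫⁻ x, ‖series ω a x‖ₑ ^ 2 =
      ∑' n : ℤ, ∫⁻ t in Set.Ico (0 : ℝ) 1, ‖localSum ω (window a n) t‖ₑ ^ 2 := by
  rw [lintegral_eq_tsum_Ico]
  refine tsum_congr fun n => setLIntegral_congr_fun measurableSet_Ico fun t ht => ?_
  have hfl : ⌊t + n⌋ = n := by rw [Int.floor_add_intCast, Int.floor_eq_zero_iff.2 ht, zero_add]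
  simp only [series_eq_localSum hω, hfl, add_sub_cancel_right]

/-- The coefficient `a (n, j)` lies in exactly the windows `n - 1` and `n`. -/
theorem tsum_window_sq (a : ℤ × Fin 2 → ℂ) :
    ∑' n : ℤ, ∑ k, ‖window a n k‖ₑ ^ 2 = 2 * ∑' i, ‖a i‖ₑ ^ 2 := by
  have hk : ∀ k : Fin 2, ∑' n : ℤ, ∑ j, ‖window a n (k, j)‖ₑ ^ 2 = ∑' i, ‖a i‖ₑ ^ 2 := by
    intro k
    rw [ENNReal.tsum_prod']
    simp only [tsum_fintype, window]
    exact (Equiv.addRight ((k : ℕ) : ℤ)).tsum_eq fun n => ∑ j, ‖a (n, j)‖ₑ ^ 2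
  simp only [Fintype.sum_prod_type]
  rw [Summable.tsum_finsetSum fun _ _ => ENNReal.summable]
  simp only [hk, Finset.sum_const, Finset.card_univ, Fintype.card_fin, nsmul_eq_mul,
    Nat.cast_ofNat]

theorem enorm_lp_sq {ι : Type*} (a : lp (fun _ : ι => ℂ) 2) : ‖a‖ₑ ^ 2 = ∑' i, ‖a i‖ₑ ^ 2 := by
  have h := lp.hasSum_norm (p := 2) (by simp) a
  simp only [ENNReal.toReal_ofNat, Real.rpow_ofNat] at h
  simp only [← ofReal_norm, ← ENNReal.ofReal_pow (norm_nonneg _)]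
  rw [← h.tsum_eq, ENNReal.ofReal_tsum_of_nonneg (fun _ => by positivity) h.summable]

theorem exists_series_bounds {ω : ℝ} (hω : ω ∈ Set.Icc (0 : ℝ) Real.pi) :
    ∃ K C : NNReal, 0 < K ∧ ∀ a : lp (fun _ : ℤ × Fin 2 => ℂ) 2,
      ‖a‖ₑ ^ 2 ≤ (K : ENNReal) ^ 2 * ∫⁻ x, ‖series ω a x‖ₑ ^ 2 ∧
      ∫⁻ x, ‖series ω a x‖ₑ ^ 2 ≤ (C : ENNReal) ^ 2 * ‖a‖ₑ ^ 2 := by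
  obtain ⟨K, C, hK, h⟩ := exists_localSum_bounds hω
  -- Double counting costs only `√2`; `2 * C` avoids the root.
  refine ⟨K, 2 * C, hK, fun a => ?_⟩
  rw [lintegral_series_sq hω, enorm_lp_sq]
  constructor
  · calc ∑' i, ‖a i‖ₑ ^ 2 ≤ 2 * ∑' i, ‖a i‖ₑ ^ 2 := le_mul_of_one_le_left' one_le_two
      _ = ∑' n : ℤ, ∑ k, ‖window a n k‖ₑ ^ 2 := (tsum_window_sq _).symm
      _ ≤ _ := by
        rw [← ENNReal.tsum_mul_left]
        exact ENNReal.tsum_le_tsum fun n => (h _).1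
  · calc _ ≤ ∑' n : ℤ, (C : ENNReal) ^ 2 * ∑ k, ‖window a n k‖ₑ ^ 2 :=
          ENNReal.tsum_le_tsum fun n => (h _).2
      _ = (C : ENNReal) ^ 2 * 2 * ∑' i, ‖a i‖ₑ ^ 2 := by
        rw [ENNReal.tsum_mul_left, tsum_window_sq, mul_assoc]
      _ ≤ _ := by
        gcongr
        push_cast
        rw [mul_pow, mul_comm]
        gcongr
        norm_num

theorem memLp_series {ω : ℝ} (hω : ω ∈ Set.Icc (0 : ℝ) Real.pi)
    (a : lp (fun _ : ℤ × Fin 2 => ℂ) 2) : MemLp (series ω a) 2 (volume : Measure ℝ) := by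
  obtain ⟨K, C, -, h⟩ := exists_series_bounds hω
  refine ⟨(measurable_series hω a).aestronglyMeasurable, ?_⟩
  have he := eLpNorm_nnreal_pow_eq_lintegral (f := series ω a) (μ := (volume : Measure ℝ))
    (p := 2) two_ne_zero
  simp only [NNReal.coe_ofNat, ENNReal.rpow_ofNat, ENNReal.coe_ofNat] at he
  refine (ENNReal.pow_lt_top_iff (n := 2)).1 ?_ |>.resolve_right two_ne_zero
  rw [he]
  exact (h a).2.trans_lt (ENNReal.mul_lt_top (by simp) (by simp))

/-! ### The synthesis operator -/

/-- The synthesis operator `a ↦ ∑ₙ a[n]ᵀ φ(· - n)` from `ℓ²` to `L²(ℝ)`. -/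
def synthesis {ω : ℝ} (hω : ω ∈ Set.Icc (0 : ℝ) Real.pi) :
    lp (fun _ : ℤ × Fin 2 => ℂ) 2 →ₗ[ℂ] Lp ℂ 2 (volume : Measure ℝ) where
  toFun a := (memLp_series hω a).toLp
  map_add' a b := by
    rw [← MemLp.toLp_add]
    refine MemLp.toLp_congr _ _ (.of_eq (funext fun x => ?_))
    -- The series becomes a finite sum at each point, so no summability is needed.
    simp only [Pi.add_apply, series_eq_localSum hω]
    exact congrFun (localSum_add ω (window a ⌊x⌋) (window b ⌊x⌋)) _
  map_smul' c a := by
    rw [RingHom.id_apply, ← MemLp.toLp_const_smul]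
    refine MemLp.toLp_congr _ _ (.of_eq (funext fun x => ?_))
    simp only [Pi.smul_apply, series_eq_localSum hω]
    exact congrFun (localSum_smul ω c (window a ⌊x⌋)) _

theorem synthesis_single {ω : ℝ} (hω : ω ∈ Set.Icc (0 : ℝ) Real.pi) (i : ℤ × Fin 2) (c : ℂ) :
    synthesis hω (lp.single 2 i c) = c • translate ω i := by
  rw [translate, ← MemLp.toLp_const_smul]
  refine MemLp.toLp_congr (memLp_series hω _) _ (.of_eq (funext fun x => ?_))
  obtain ⟨n, j⟩ := i
  rw [series, tsum_eq_single n]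
  · fin_cases j <;> simp
  · intro m hm
    simp [hm]

theorem exists_synthesis_bounds {ω : ℝ} (hω : ω ∈ Set.Icc (0 : ℝ) Real.pi) :
    ∃ K C : NNReal, 0 < K ∧ ∀ a, ‖a‖ ≤ K * ‖synthesis hω a‖ ∧ ‖synthesis hω a‖ ≤ C * ‖a‖ := by
  obtain ⟨K, C, hK, h⟩ := exists_series_bounds hω
  refine ⟨K, C, hK, fun a => ?_⟩
  have h1 : ∫⁻ x, ‖series ω a x‖ₑ ^ 2 = ‖synthesis hω a‖ₑ ^ 2 :=
    (enorm_toLp_sq (memLp_series hω a)).symm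
  have h2 := h a
  rw [h1, ← mul_pow, ← mul_pow, ENNReal.pow_le_pow_left_iff two_ne_zero,
    ENNReal.pow_le_pow_left_iff two_ne_zero] at h2
  simp only [enorm_eq_nnnorm] at h2
  exact_mod_cast h2

/-- In `ℓ²` the family `a` is the unconditional sum of its coordinates, and a continuous linear map
preserves this. -/
theorem hasSum_synthesis {ω : ℝ} (hω : ω ∈ Set.Icc (0 : ℝ) Real.pi)
    (a : lp (fun _ : ℤ × Fin 2 => ℂ) 2) :
    HasSum (fun i => a i • translate ω i) (synthesis hω a) := by
  obtain ⟨K, C, -, h⟩ := exists_synthesis_bounds hω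
  have := ((synthesis hω).mkContinuous C fun a => (h a).2).hasSum
    (lp.hasSum_single (p := 2) (by simp) a)
  simpa [synthesis_single] using this

theorem splineSpace_eq_range {ω : ℝ} (hω : ω ∈ Set.Icc (0 : ℝ) Real.pi) :
    splineSpace ω = Set.range (synthesis hω) := by
  ext f
  refine exists_congr fun a => ⟨fun h => ?_, fun h => h ▸ MemLp.coeFn_toLp (memLp_series hω a)⟩
  exact Lp.ext ((MemLp.coeFn_toLp (memLp_series hω a)).trans h.symm)

end HermiteESpline

end

theorem mainTheorem1 (ω₀ : ℝ) (hω₀ : ω₀ ∈ Set.Icc (0 : ℝ) Real.pi) :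
    HermiteESpline.IsRieszBasis (HermiteESpline.translate ω₀)
      (HermiteESpline.splineSpace ω₀) := by
  open HermiteESpline in
  obtain ⟨K, C, hK, h⟩ := exists_synthesis_bounds hω₀
  have hK' : (0 : ℝ) < K := hK
  -- The maximum serves only to ensure `α ≤ β`.
  refine ⟨?_, (K : ℝ)⁻¹, max (K : ℝ)⁻¹ C, inv_pos.2 hK', le_max_left _ _, fun a => ?_⟩
  · rw [splineSpace_eq_range hω₀]
    refine Set.Subset.antisymm ?_ ?_
    · have hcl : IsClosed (LinearMap.range (synthesis hω₀) : Set (Lp ℂ 2 (volume : Measure ℝ))) := by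
        set T := (synthesis hω₀).mkContinuous C fun a => (h a).2
        -- Bounded below on the complete space `ℓ²`, hence closed range.
        exact (T.antilipschitz_of_bound fun a => (h a).1).isClosed_range T.uniformContinuous
      refine Submodule.topologicalClosure_minimal _ ?_ hcl
      rw [Submodule.span_le]
      rintro _ ⟨i, rfl⟩
      exact ⟨lp.single 2 i 1, by rw [synthesis_single, one_smul]⟩
    · rintro _ ⟨a, rfl⟩
      refine mem_closure_of_tendsto (hasSum_synthesis hω₀ a) (.of_forall fun s => ?_)
      exact Submodule.sum_mem _ fun i _ =>
        Submodule.smul_mem _ _ (Submodule.subset_span ⟨i, rfl⟩)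
  · have hs := hasSum_synthesis hω₀ a
    refine ⟨hs.summable, ?_, ?_⟩
    · rw [hs.tsum_eq, inv_mul_le_iff₀ hK']
      exact (h a).1
    · rw [hs.tsum_eq]
      exact (h a).2.trans (by gcongr; exact le_max_right _ _)
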